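/- **Theorem (good trees).** Let $V,H,C,G$ be pairwise disjoint sets of signals, where $I=V\cup H$ are the (visible and hidden) input signals and $O=C\cup G$ are the (controlled and guided) output signals. Let $\varphi$ be an LTL formula over $I\cup O$, built from $\mathtt{true}$, $\mathtt{false}$ and the signals with $\neg,\wedge,\vee,\rightarrow,\leftrightarrow$ and the temporal operators $\mathbf X,\mathbf F,\mathbf G,\mathbf U$, and let $|\varphi|$ be the number of nodes of its generating tree. Let $M$ be a finite set of memories with an initial memory $m_0\in M$, and let $\mathcal P_{M,H,G}$ be the set of all functions (programs) $p:M\times 2^H\to M\times 2^G$. A $(2^C\times\mathcal P_{M,H,G})$-labeled $2^V$-tree is a function $\ell$ that labels each edge $\langle x,x\cdot v\rangle$ ($x\in(2^V)^*$, $v\in 2^V$) of the full tree $(2^V)^*$ by a letter $\ell(x,x\cdot v)\in 2^C\times\mathcal P_{M,H,G}$. Given $w_V=v_1v_2\cdots\in(2^V)^\omega$, let $\langle c_j,p_j\rangle=\ell(v_1\cdots v_{j-1},v_1\cdots v_j)$ for $j\ge 1$. Given $w_H=h_1h_2\cdots\in(2^H)^\omega$, let $\langle m_j,g_j\rangle=p_j(m_{j-1},h_j)$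 for $j\ge1$. The operation of $\ell(w_V)$ on $w_H$ is the computation $(v_1\cup h_1\cup c_1\cup g_1)(v_2\cup h_2\cup c_2\cup g_2)\cdots\in(2^{I\cup O})^\omega$. The tree $\ell$ is $\varphi$-good if for all $w_V\in(2^V)^\omega$ and $w_H\in(2^H)^\omega$, the operation of $\ell(w_V)$ on $w_H$ satisfies $\varphi$. A universal co-Büchi tree automaton (UCT) over $\Sigma$-labeled $\Upsilon$-trees consists of a finite state set $Q$, an initial state $q_0\in Q$, a transition function $\eta:Q\times\Sigma\times\Upsilon\to 2^Q$ and a set $\alpha\subseteq Q$. Its run on a $\Sigma$-labeled $\Upsilon$-tree $\ell$ starts with one copy in state $q_0$ at the root, and a copy in state $q$ at node $x$ sends, for every direction $a\in\Upsilon$ and every $q'\in\eta(q,\ell(x,x\cdot a),a)$, a copy in state $q'$ to the node $x\cdot a$. The automaton accepts $\ell$ if every infinite path of the run tree visits each state of $\alpha$ only finitely often. Then there is a UCT $\mathcal A_\varphi$ with $2^{|\varphi|}\cdot|M|$ states that runs on $(2^C\times\mathcal P_{M,H,G})$-labeled $2^V$-trees and accepts such a tree $\ell$ if and only if $\ell$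 is $\varphi$-good. -/

import Mathlib

/-- LTL formulas over a set `AP` of atomic propositions. -/
inductive LTL (AP : Type*) where
  | tt : LTL AP
  | ff : LTL AP
  | atom : AP → LTL AP
  | not : LTL AP → LTL AP
  | and : LTL AP → LTL AP → LTL AP
  | or : LTL AP → LTL AP → LTL AP
  | imp : LTL AP → LTL AP → LTL AP
  | iff : LTL AP → LTL AP → LTL AP
  | next : LTL AP → LTL AP
  | eventually : LTL AP → LTL AP
  | always : LTL AP → LTL AP
  | untl : LTL AP → LTL AP → LTL AP

namespace LTL

/-- The length of a formula: the number of nodes of its generating tree. -/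
def length {AP : Type*} : LTL AP → ℕ
  | tt => 1
  | ff => 1
  | atom _ => 1
  | not φ => φ.length + 1
  | and φ ψ => φ.length + ψ.length + 1
  | or φ ψ => φ.length + ψ.length + 1
  | imp φ ψ => φ.length + ψ.length + 1
  | iff φ ψ => φ.length + ψ.length + 1
  | next φ => φ.length + 1
  | eventually φ => φ.length + 1
  | always φ => φ.length + 1
  | untl φ ψ => φ.length + ψ.length + 1

/-- `φ.SatAt w i`: the suffix of the computation `w` that starts at position `i` satisfies `φ`. -/
def SatAt {AP : Type*} : LTL AP → (ℕ → Set AP) → ℕ → Prop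
  | tt, _, _ => True
  | ff, _, _ => False
  | atom p, w, i => p ∈ w i
  | not φ, w, i => ¬ φ.SatAt w i
  | and φ ψ, w, i => φ.SatAt w i ∧ ψ.SatAt w i
  | or φ ψ, w, i => φ.SatAt w i ∨ ψ.SatAt w i
  | imp φ ψ, w, i => φ.SatAt w i → ψ.SatAt w i
  | iff φ ψ, w, i => (φ.SatAt w i ↔ ψ.SatAt w i)
  | next φ, w, i => φ.SatAt w (i + 1)
  | eventually φ, w, i => ∃ j, i ≤ j ∧ φ.SatAt w j
  | always φ, w, i => ∀ j, i ≤ j → φ.SatAt w j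
  | untl φ ψ, w, i => ∃ j, i ≤ j ∧ ψ.SatAt w j ∧ ∀ k, i ≤ k → k < j → φ.SatAt w k

/-- The computation `w` satisfies `φ`. -/
def Sat {AP : Type*} (φ : LTL AP) (w : ℕ → Set AP) : Prop :=
  φ.SatAt w 0

end LTL

/-- An `A`-labeled `D`-tree: the full tree of nodes `List D` (the root is `[]`), with a letter on
each edge; `ℓ x a` is the letter on the edge from `x` to its successor `x ++ [a]`. -/
abbrev LabeledTree (A D : Type*) := List D → D → A

/-- The prefix `w 0, …, w (n - 1)` of an infinite word. -/
def wordPrefix {D : Type*} (w : ℕ → D) (n : ℕ) : List D :=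
  (List.range n).map w

/-- The sequence of labels along the path of a labeled tree induced by an infinite word. -/
def LabeledTree.along {A D : Type*} (ℓ : LabeledTree A D) (w : ℕ → D) : ℕ → A :=
  fun j => ℓ (wordPrefix w j) (w j)

/-- A universal co-Büchi tree automaton (UCT) over `A`-labeled `D`-trees. -/
structure UCT (A D : Type*) where
  /-- the states -/
  State : Type
  finite_state : Finite State
  /-- the initial state -/
  init : State
  /-- the transition function -/
  trans : State → A → D → Set State
  /-- the co-Büchi acceptance condition: the states that may be visited only finitely often -/
  acc : Set State

namespace UCT

variable {A D : Type*}

/-- The run of a UCT on a labeled tree. `𝒜.Run ℓ y x q` says that `y` is a node of the run tree and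
is labeled by the pair `(x, q)`, that is, `y` is a copy of `𝒜` in state `q` that reads the node `x`
of the input tree. -/
inductive Run (𝒜 : UCT A D) (ℓ : LabeledTree A D) :
    List (D × 𝒜.State) → List D → 𝒜.State → Prop
  | root : Run 𝒜 ℓ [] [] 𝒜.init
  | succ {y : List (D × 𝒜.State)} {x : List D} {q : 𝒜.State} (a : D) (q' : 𝒜.State) :
      Run 𝒜 ℓ y x q → q' ∈ 𝒜.trans q (ℓ x a) a →
        Run 𝒜 ℓ (y ++ [(a, q')]) (x ++ [a]) q'

/-- `π` is (the word associated with) an infinite path of the run tree. -/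
def IsPath (𝒜 : UCT A D) (ℓ : LabeledTree A D) (π : ℕ → D × 𝒜.State) : Prop :=
  ∀ n, ∃ x q, 𝒜.Run ℓ (wordPrefix π n) x q

/-- The states that the path `π` of the run tree visits infinitely often. -/
def infStates (𝒜 : UCT A D) (ℓ : LabeledTree A D) (π : ℕ → D × 𝒜.State) : Set 𝒜.State :=
  {q | {n : ℕ | ∃ x, 𝒜.Run ℓ (wordPrefix π n) x q}.Infinite}

/-- A labeled tree is accepted if every infinite path of the run tree satisfies the co-Büchi
condition. -/
def Accepts (𝒜 : UCT A D) (ℓ : LabeledTree A D) : Prop :=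
  ∀ π, 𝒜.IsPath ℓ π → 𝒜.infStates ℓ π ∩ 𝒜.acc = ∅

end UCT

/-- The signals, partitioned into visible and hidden input signals and controlled and guided
output signals. -/
inductive Signal (V H C G : Type*) where
  | visible : V → Signal V H C G
  | hidden : H → Signal V H C G
  | controlled : C → Signal V H C G
  | guided : G → Signal V H C G

/-- The assignment `v ∪ h ∪ c ∪ g` to all signals. -/
def joinAssignment {V H C G : Type*} (v : Set V) (h : Set H) (c : Set C) (g : Set G) :
    Set (Signal V H C G) :=
  {s | match s with
    | .visible x => x ∈ v
    | .hidden x => x ∈ h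
    | .controlled x => x ∈ c
    | .guided x => x ∈ g}

/-- Propositional programs: they update the memory state and assign values to the guided
signals, given a memory state and an assignment to the hidden signals. -/
abbrev Program (M H G : Type*) := M × Set H → M × Set G

/-- The sequence of memory states `m₀, m₁, …` obtained by executing the programs `p` on the
hidden input sequence `wH`, starting from `m₀`. -/
def memorySeq {M H G : Type*} (m₀ : M) (p : ℕ → Program M H G) (wH : ℕ → Set H) : ℕ → M
  | 0 => m₀
  | j + 1 => (p j (memorySeq m₀ p wH j, wH j)).1

/-- The operation on `wH` of the sequence `L` of labels along the visible input sequence `wV`. -/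
def operation {V H C G M : Type*} (m₀ : M) (wV : ℕ → Set V) (L : ℕ → Set C × Program M H G)
    (wH : ℕ → Set H) : ℕ → Set (Signal V H C G) :=
  fun j => joinAssignment (wV j) (wH j) (L j).1
    ((L j).2 (memorySeq m₀ (fun i => (L i).2) wH j, wH j)).2

/-- A labeled tree is `φ`-good (with respect to the initial memory `m₀`) if all its operations
on hidden input sequences satisfy `φ`. -/
def IsGood {V H C G M : Type*} (φ : LTL (Signal V H C G)) (m₀ : M)
    (ℓ : LabeledTree (Set C × Program M H G) (Set V)) : Prop :=
  ∀ (wV : ℕ → Set V) (wH : ℕ → Set H), φ.Sat (operation m₀ wV (ℓ.along wV) wH)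

/-! A tree fails to be good iff some visible sequence, some hidden sequence and some accepting run
of a Büchi automaton `N` for `¬φ` fit together. The UCT is built so that its paths are these runs: a
copy stores a state of `N` and the current memory, universal branching ranges over the hidden
letters and the choices of `N`, and co-Büchi acceptance forbids recurrent visits to `N.acc`. It
remains to find `N` with `2 ^ |φ|` states (`LTL.buchiRecognizable_not_sat`).

`N` guesses one bit per temporal operator. Bits that obey the expansion laws and recurrently meet
the fairness conditions are the truth values (`LTL.val_iff_satAt`), and the truth values are such
bits (`LTL.consistent_truthBits`, `LTL.isFair_truthBits`). For `X ψ` the bit records `ψ` itself, so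
that consistency never looks beyond the next position.

The difficulty is the exact bound. With `t` temporal nodes, `s` other nodes and `k` conditions,
degeneralization gives `2 ^ t * (k + 1) + 1` states, so `k + 1 < 2 ^ s` is needed. One condition for
each `F`, `G` and `U` is too many, because a chain of `F` and `G` does not increase `s`. But above
the innermost `F` or `G` of such a chain all truth values are eventually constant, so one recurrent
condition serves the whole chain (`LTL.chainFair_truthBits_aux`), and `k` becomes linear in `s`
(`LTL.exists_length_eq`). Treating the root operator separately absorbs the remaining constants. -/

open Filter

/-! ### Büchi word automata and their padding, delay and waiting constructions -/

/-- Nondeterministic Büchi word automata over the alphabet `A` with state space `S`. -/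
structure NBW (A : Type*) (S : Type) where
  /-- the initial state -/
  init : S
  /-- the transition relation -/
  trans : S → A → S → Prop
  /-- the states one of which has to be visited infinitely often -/
  acc : Set S

namespace NBW

variable {A : Type*} {S : Type}

/-- The infinite word `w` is accepted. -/
def Accepts (N : NBW A S) (w : ℕ → A) : Prop :=
  ∃ ρ : ℕ → S, ρ 0 = N.init ∧ (∀ i, N.trans (ρ i) (w i) (ρ (i + 1))) ∧ ∃ᶠ i in atTop, ρ i ∈ N.acc

end NBW

/-- The language `L` is recognized by a nondeterministic Büchi automaton with `n` states. -/
def BuchiRecognizable {A : Type*} (n : ℕ) (L : (ℕ → A) → Prop) : Prop :=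
  ∃ N : NBW A (Fin n), ∀ w, N.Accepts w ↔ L w

/-- An automaton may be padded with unreachable states. -/
theorem NBW.buchiRecognizable {A : Type*} {S : Type} [Finite S] (N : NBW A S) {n : ℕ}
    (hn : Nat.card S ≤ n) {L : (ℕ → A) → Prop} (hL : ∀ w, N.Accepts w ↔ L w) :
    BuchiRecognizable n L := by
  let f : S → Fin n := fun s => Fin.castLE hn (Finite.equivFin S s)
  have hf : Function.Injective f :=
    (Fin.castLE_injective hn).comp (Finite.equivFin S).injective
  refine ⟨⟨f N.init, fun x a y => ∃ s t, f s = x ∧ f t = y ∧ N.trans s a t, f '' N.acc⟩,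
    fun w => ?_⟩
  rw [← hL]
  constructor
  · rintro ⟨ρ, h0, hs, ha⟩
    -- States outside the range of `f` have no outgoing transitions, so no infinite run meets them.
    have hex : ∀ i, ∃ s, f s = ρ i := fun i => by
      obtain ⟨s, t, h, -⟩ := hs i
      exact ⟨s, h⟩
    choose σ hσ using hex
    refine ⟨σ, hf ((hσ 0).trans h0), fun i => ?_, ha.mono fun i hi => ?_⟩
    · obtain ⟨s, t, h1, h2, h3⟩ := hs i
      rw [← hσ] at h1 h2
      rwa [← hf h1, ← hf h2]
    · obtain ⟨s, h1, h2⟩ := hi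
      rw [← hσ] at h2
      rwa [← hf h2]
  · rintro ⟨ρ, h0, hs, ha⟩
    exact ⟨fun i => f (ρ i), congrArg f h0, fun i => ⟨_, _, rfl, rfl, hs i⟩,
      ha.mono fun i hi => ⟨_, hi, rfl⟩⟩

theorem BuchiRecognizable.mono {A : Type*} {m n : ℕ} {L : (ℕ → A) → Prop}
    (h : BuchiRecognizable m L) (hmn : m ≤ n) : BuchiRecognizable n L := by
  obtain ⟨N, hN⟩ := h
  exact N.buchiRecognizable (by simpa using hmn) hN

theorem BuchiRecognizable.congr {A : Type*} {n : ℕ} {L L' : (ℕ → A) → Prop}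
    (h : BuchiRecognizable n L) (hL : ∀ w, L w ↔ L' w) : BuchiRecognizable n L' := by
  obtain ⟨N, hN⟩ := h
  exact ⟨N, fun w => (hN w).trans (hL w)⟩

theorem frequently_atTop_add_iff {p : ℕ → Prop} (k : ℕ) :
    (∃ᶠ i in atTop, p (i + k)) ↔ ∃ᶠ i in atTop, p i := by
  rw [← frequently_map (m := fun i => i + k) (P := p), map_add_atTop_eq_nat]

theorem BuchiRecognizable.next {A : Type*} {n : ℕ} {L : (ℕ → A) → Prop}
    (h : BuchiRecognizable n L) :
    BuchiRecognizable (n + 1) fun w => L fun i => w (i + 1) := by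
  obtain ⟨N, hN⟩ := h
  let N' : NBW A (Option (Fin n)) :=
    ⟨none, fun x a y => match x, y with
      | none, some t => t = N.init
      | some s, some t => N.trans s a t
      | _, none => False, some '' N.acc⟩
  refine N'.buchiRecognizable (by simp) fun w => ?_
  rw [← hN]
  constructor
  · rintro ⟨ρ, h0, hs, ha⟩
    have hex : ∀ i, ∃ s, ρ (i + 1) = some s := fun i => by
      have := hs i
      cases h : ρ (i + 1) with
      | none => rw [h] at this; cases h' : ρ i <;> simp [N', h'] at this
      | some s => exact ⟨s, rfl⟩
    choose σ hσ using hex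
    refine ⟨σ, ?_, fun i => ?_, ?_⟩
    · have := hs 0
      rw [h0, hσ] at this
      exact this
    · have := hs (i + 1)
      rw [hσ, hσ] at this
      exact this
    · rw [← frequently_atTop_add_iff 1] at ha
      refine ha.mono fun i hi => ?_
      simpa [hσ, N'] using hi
  · rintro ⟨ρ, h0, hs, ha⟩
    refine ⟨fun i => Nat.casesOn i none fun j => some (ρ j), rfl, fun i => ?_, ?_⟩
    · cases i with
      | zero => exact h0
      | succ i => exact hs i
    · rw [← frequently_atTop_add_iff 1]
      exact ha.mono fun i hi => ⟨_, hi, rfl⟩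

/-- A single new state waits for the suffix. It is not accepting, so an accepting run has to leave
it. -/
theorem BuchiRecognizable.eventually {A : Type*} {n : ℕ} {L : (ℕ → A) → Prop}
    (h : BuchiRecognizable n L) :
    BuchiRecognizable (n + 1) fun w => ∃ j, L fun i => w (i + j) := by
  obtain ⟨N, hN⟩ := h
  let N' : NBW A (Option (Fin n)) :=
    ⟨none, fun x a y => match x, y with
      | none, none => True
      | none, some t => N.trans N.init a t
      | some s, some t => N.trans s a t
      | some _, none => False, some '' N.acc⟩
  refine N'.buchiRecognizable (by simp) fun w => ?_
  simp_rw [← hN]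
  constructor
  · rintro ⟨ρ, h0, hs, ha⟩
    have hex : ∃ i, ρ i ≠ none := by
      obtain ⟨i, s, -, hi⟩ := ha.exists
      exact ⟨i, by simp [← hi]⟩
    classical
    obtain ⟨j, hj⟩ : ∃ j, Nat.find hex = j + 1 := by
      refine Nat.exists_eq_succ_of_ne_zero fun h => ?_
      have := Nat.find_spec hex
      rw [h] at this
      exact this h0
    have hnone : ρ j = none := by
      by_contra h
      exact absurd (Nat.find_min' hex h) (by omega)
    have hsome : ∀ i, ∃ s, ρ (i + 1 + j) = some s := by
      intro i
      rw [← Option.ne_none_iff_exists']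
      induction i with
      | zero =>
        have := Nat.find_spec hex
        rwa [hj, add_comm] at this
      | succ i ih =>
        intro h
        have := hs (i + 1 + j)
        rw [show i + 1 + j + 1 = i + 1 + 1 + j by ring, h] at this
        obtain ⟨s, hs⟩ := Option.ne_none_iff_exists'.1 ih
        rw [hs] at this
        exact this
    choose σ hσ using hsome
    refine ⟨j, fun i => Nat.casesOn i N.init σ, rfl, fun i => ?_, ?_⟩
    · have := hs (i + j)
      rw [show i + j + 1 = i + 1 + j by ring, hσ] at this
      cases i with
      | zero => rw [zero_add, hnone] at this; simpa using this
      | succ i => rw [hσ] at this; exact this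
    · rw [← frequently_atTop_add_iff 1]
      rw [← frequently_atTop_add_iff (1 + j)] at ha
      refine ha.mono fun i hi => ?_
      rw [← add_assoc, hσ] at hi
      simpa [N'] using hi
  · rintro ⟨j, ρ, h0, hs, ha⟩
    refine ⟨fun i => if i ≤ j then none else some (ρ (i - j)), by simp [N'], fun i => ?_, ?_⟩
    · rcases lt_trichotomy i j with hij | rfl | hij
      · simp [hij.le, Nat.succ_le_of_lt hij, N']
      · have := hs 0
        simpa [N', h0] using this
      · obtain ⟨k, rfl⟩ := Nat.exists_eq_add_of_lt hij
        have := hs (k + 1)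
        simp only [show ¬ j + k + 1 ≤ j by omega, show ¬ j + k + 1 + 1 ≤ j by omega, if_false, N',
          show j + k + 1 - j = k + 1 by omega, show j + k + 1 + 1 - j = k + 1 + 1 by omega]
        rwa [show j + k + 1 = k + 1 + j by ring]
    · rw [← frequently_atTop_add_iff (j + 1)]
      rw [← frequently_atTop_add_iff 1] at ha
      refine ha.mono fun i hi => ?_
      simpa [N', show ¬ i + (j + 1) ≤ j by omega, show i + (j + 1) - j = i + 1 by omega] using hi

/-! ### Degeneralization of fairness conditions -/

/-- The counter that waits in turn for each of `n` conditions `P 0, …, P (n - 1)` and is reset when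
all of them have been seen. -/
noncomputable def fairCounter (n : ℕ) (P : ℕ → ℕ → Prop) : ℕ → ℕ
  | 0 => 0
  | i + 1 => open Classical in
    if fairCounter n P i = n then 0
    else if P (fairCounter n P i) i then fairCounter n P i + 1 else fairCounter n P i

/-- A counter that is incremented only when the awaited condition holds and reset at `n`, reaches
`n` infinitely often if and only if all conditions hold infinitely often. -/
theorem frequently_counter_eq_iff {n : ℕ} {P : ℕ → ℕ → Prop} {c : ℕ → ℕ} (hn : ∀ i, c i ≤ n)
    (hreset : ∀ i, c i = n → c (i + 1) = 0)
    (hinc : ∀ i, c i ≠ n → P (c i) i → c (i + 1) = c i + 1)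
    (hstay : ∀ i, c i ≠ n → ¬ P (c i) i → c (i + 1) = c i) :
    (∃ᶠ i in atTop, c i = n) ↔ ∀ k < n, ∃ᶠ i in atTop, P k i := by
  simp only [frequently_atTop]
  constructor
  · intro h k hk a
    obtain ⟨i, hi, hin⟩ := h a
    obtain ⟨j, hj, hjn⟩ := h (i + 1)
    by_contra hP
    push Not at hP
    -- After a reset, a counter whose `k`-th condition never holds again is stuck at or below `k`,
    -- hence never returns to `n`.
    have key : ∀ d, c (i + 1 + d) ≤ k := by
      intro d
      induction d with
      | zero => simp [hreset i hin]
      | succ d ih =>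
        rw [← add_assoc]
        have hne : c (i + 1 + d) ≠ n := by omega
        by_cases hp : P (c (i + 1 + d)) (i + 1 + d)
        · have : c (i + 1 + d) ≠ k := fun h => hP (i + 1 + d) (by omega) (h ▸ hp)
          rw [hinc _ hne hp]; omega
        · rw [hstay _ hne hp]; exact ih
    obtain ⟨d, rfl⟩ := Nat.exists_eq_add_of_le hj
    have := key d
    omega
  · intro h a
    by_contra hc
    push Not at hc
    -- From `a` on there are no resets, so the counter passes every level.
    have key : ∀ k ≤ n, ∃ i ≥ a, k ≤ c i := by
      intro k
      induction k with
      | zero => exact fun _ => ⟨a, le_rfl, Nat.zero_le _⟩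
      | succ k ih =>
        intro hk
        obtain ⟨i, hi, hki⟩ := ih (by omega)
        by_contra hcon
        push Not at hcon
        have hall : ∀ d, c (i + d) = k := by
          intro d
          induction d with
          | zero => have := hcon i hi; simp only [add_zero]; omega
          | succ d ihd =>
            rw [← add_assoc]
            have h1 := hc (i + d) (by omega)
            have h2 := hcon (i + d + 1) (by omega)
            by_cases hp : P (c (i + d)) (i + d)
            · rw [hinc _ h1 hp] at h2; omega
            · rw [hstay _ h1 hp, ihd]
        obtain ⟨j, hj, hPj⟩ := h k (by omega) i
        obtain ⟨d, rfl⟩ := Nat.exists_eq_add_of_le hj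
        have h1 := hc (i + d) (by omega)
        have h2 := hcon (i + d + 1) (by omega)
        rw [hinc _ h1 (by rwa [hall]), hall] at h2
        omega
    obtain ⟨i, hi, hni⟩ := key n le_rfl
    exact hc i hi (le_antisymm (hn i) hni)

/-- Degeneralization: the words that label a path of a finite transition system which satisfies
each of `n` fairness conditions infinitely often. -/
theorem buchiRecognizable_of_fair {A : Type*} {B : Type} [Finite B] (I T : B → A → B → Prop)
    (Cs : List (B → A → B → Prop)) :
    BuchiRecognizable (Nat.card B * (Cs.length + 1) + 1) fun w => ∃ b : ℕ → B,
      I (b 0) (w 0) (b 1) ∧ (∀ i, T (b i) (w i) (b (i + 1))) ∧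
      ∀ C ∈ Cs, ∃ᶠ i in atTop, C (b i) (w i) (b (i + 1)) := by
  have : Fintype B := Fintype.ofFinite B
  let D : ℕ → B → A → B → Prop := fun k b a b' => ∃ h : k < Cs.length, Cs[k] b a b'
  let N : NBW A (Option (B × Fin (Cs.length + 1))) :=
    ⟨none, fun x a y => match x, y with
      -- The first label `b` is guessed and checked within the first transition, so a single initial
      -- state suffices. The counter starts only at position 1; recurrence is insensitive to this
      -- shift.
      | none, some (b', c') => c' = 0 ∧ ∃ b, I b a b' ∧ T b a b'
      | some (b, c), some (b', c') => T b a b' ∧ (c.1 = Cs.length → c'.1 = 0) ∧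
          (c.1 ≠ Cs.length → D c.1 b a b' → c'.1 = c.1 + 1) ∧
          (c.1 ≠ Cs.length → ¬ D c.1 b a b' → c'.1 = c.1)
      | _, none => False, {x | ∃ b, x = some (b, Fin.last _)}⟩
  have hfair : ∀ (w : ℕ → A) (b : ℕ → B),
      (∀ C ∈ Cs, ∃ᶠ i in atTop, C (b i) (w i) (b (i + 1))) ↔
      ∀ k < Cs.length, ∃ᶠ i in atTop, D k (b (i + 1)) (w (i + 1)) (b (i + 1 + 1)) := by
    intro w b
    simp only [List.forall_mem_iff_getElem]
    refine forall₂_congr fun k hk => ?_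
    rw [← frequently_atTop_add_iff 1]
    simp [D, hk]
  refine N.buchiRecognizable (by simp) fun w => ?_
  constructor
  · rintro ⟨ρ, h0, hs, ha⟩
    have hex : ∀ i, ∃ s, ρ (i + 1) = some s := fun i => by
      have := hs i
      cases h : ρ (i + 1) with
      | none => rw [h] at this; cases h' : ρ i <;> simp [N, h'] at this
      | some s => exact ⟨s, rfl⟩
    choose σ hσ using hex
    have hs0 := hs 0
    rw [h0, hσ] at hs0
    obtain ⟨-, b₀, hI, hT⟩ := hs0
    have hss : ∀ i, N.trans (some (σ i)) (w (i + 1)) (some (σ (i + 1))) := fun i => by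
      have := hs (i + 1)
      rwa [hσ, hσ] at this
    refine ⟨fun i => Nat.casesOn i b₀ fun j => (σ j).1, hI, fun i => ?_, ?_⟩
    · cases i with
      | zero => exact hT
      | succ i => exact (hss i).1
    · rw [hfair]
      refine (frequently_counter_eq_iff (c := fun i => (σ i).2.1) (fun i => by omega)
        (fun i => (hss i).2.1) (fun i => (hss i).2.2.1) (fun i => (hss i).2.2.2)).1 ?_
      rw [← frequently_atTop_add_iff 1] at ha
      refine ha.mono fun i hi => ?_
      obtain ⟨b, hb⟩ := hi
      rw [hσ, Option.some_inj] at hb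
      simp [hb]
  · rintro ⟨b, hI, hT, hC⟩
    rw [hfair] at hC
    let c := fairCounter Cs.length fun k i => D k (b (i + 1)) (w (i + 1)) (b (i + 1 + 1))
    have hc : ∀ i, c i ≤ Cs.length := fun i => by
      induction i with
      | zero => exact Nat.zero_le _
      | succ i ih =>
        simp only [c, fairCounter] at ih ⊢
        split_ifs <;> omega
    have h1 : ∀ i, c i = Cs.length → c (i + 1) = 0 := fun i h => by
      simp only [c, fairCounter] at h ⊢
      rw [if_pos h]
    have h2 : ∀ i, c i ≠ Cs.length → D (c i) (b (i + 1)) (w (i + 1)) (b (i + 1 + 1)) →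
        c (i + 1) = c i + 1 := fun i h h' => by
      simp only [c, fairCounter] at h h' ⊢
      rw [if_neg h, if_pos h']
    have h3 : ∀ i, c i ≠ Cs.length → ¬ D (c i) (b (i + 1)) (w (i + 1)) (b (i + 1 + 1)) →
        c (i + 1) = c i := fun i h h' => by
      simp only [c, fairCounter] at h h' ⊢
      rw [if_neg h, if_neg h']
    refine ⟨fun i => Nat.casesOn i none fun j => some (b (j + 1), ⟨c j, Nat.lt_succ_of_le (hc j)⟩),
      rfl, fun i => ?_, ?_⟩
    · cases i with
      | zero => exact ⟨rfl, _, hI, hT 0⟩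
      | succ i => exact ⟨hT _, h1 i, h2 i, h3 i⟩
    · rw [← frequently_atTop_add_iff 1]
      refine ((frequently_counter_eq_iff hc h1 h2 h3).2 hC).mono fun i hi => ?_
      exact ⟨b (i + 1), by simp [Fin.ext_iff, hi]⟩

/-! ### Bits for temporal operators, their consistency and fairness -/

namespace LTL

variable {AP : Type*}

theorem satAt_add_iff (φ : LTL AP) (w : ℕ → Set AP) (j i : ℕ) :
    φ.SatAt w (i + j) ↔ φ.SatAt (fun n => w (n + j)) i := by
  have shift : ∀ {p q : ℕ → Prop}, (∀ k, p (k + j) ↔ q k) → ∀ i,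
      (∃ k, i + j ≤ k ∧ p k) ↔ ∃ k, i ≤ k ∧ q k := by
    intro p q h i
    constructor
    · rintro ⟨k, hk, hp⟩
      obtain ⟨d, rfl⟩ := Nat.exists_eq_add_of_le' (le_trans (Nat.le_add_left j i) hk)
      exact ⟨d, by omega, (h d).1 hp⟩
    · rintro ⟨k, hk, hq⟩
      exact ⟨k + j, by omega, (h k).2 hq⟩
  have shift' : ∀ {p q : ℕ → Prop}, (∀ k, p (k + j) ↔ q k) → ∀ i,
      (∀ k, i + j ≤ k → p k) ↔ ∀ k, i ≤ k → q k := by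
    intro p q h i
    have := shift (p := fun k => ¬ p k) (q := fun k => ¬ q k) (fun k => not_congr (h k)) i
    simpa using not_congr this
  induction φ generalizing i with
  | tt | ff | atom => exact Iff.rfl
  | not φ ih => exact not_congr (ih i)
  | and φ ψ ih ih' => exact and_congr (ih i) (ih' i)
  | or φ ψ ih ih' => exact or_congr (ih i) (ih' i)
  | imp φ ψ ih ih' => exact imp_congr (ih i) (ih' i)
  | iff φ ψ ih ih' => exact iff_congr (ih i) (ih' i)
  | next φ ih => simp only [SatAt, ← ih, add_right_comm]
  | eventually φ ih => exact shift ih i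
  | always φ ih => exact shift' ih i
  | untl φ ψ ih ih' =>
    refine shift (fun k => and_congr (ih' k) ?_) i
    refine shift' (p := fun l => l < k + j → φ.SatAt w l) (fun l => ?_) i
    exact imp_congr (Nat.add_lt_add_iff_right) (ih l)

/-- One bit for each temporal operator of the formula. -/
def Bits : LTL AP → Type
  | tt => Unit
  | ff => Unit
  | atom _ => Unit
  | not φ => φ.Bits
  | and φ ψ => φ.Bits × ψ.Bits
  | or φ ψ => φ.Bits × ψ.Bits
  | imp φ ψ => φ.Bits × ψ.Bits
  | iff φ ψ => φ.Bits × ψ.Bits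
  | next φ => Bool × φ.Bits
  | eventually φ => Bool × φ.Bits
  | always φ => Bool × φ.Bits
  | untl φ ψ => Bool × φ.Bits × ψ.Bits

/-- The truth value of a formula, given the bits and the letter at the current position and the bits
at the next position. The bit of `next φ` is the truth value of `φ`; the bits of the other temporal
operators are the truth values of the formulas that start with them. -/
def Val : (φ : LTL AP) → φ.Bits → Set AP → φ.Bits → Prop
  | tt, _, _, _ => True
  | ff, _, _, _ => False
  | atom p, _, a, _ => p ∈ a
  | not φ, b, a, b' => ¬ φ.Val b a b'
  | and φ ψ, b, a, b' => φ.Val b.1 a b'.1 ∧ ψ.Val b.2 a b'.2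
  | or φ ψ, b, a, b' => φ.Val b.1 a b'.1 ∨ ψ.Val b.2 a b'.2
  | imp φ ψ, b, a, b' => φ.Val b.1 a b'.1 → ψ.Val b.2 a b'.2
  | iff φ ψ, b, a, b' => (φ.Val b.1 a b'.1 ↔ ψ.Val b.2 a b'.2)
  | next _, _, _, b' => b'.1 = true
  | eventually _, b, _, _ => b.1 = true
  | always _, b, _, _ => b.1 = true
  | untl _ _, b, _, _ => b.1 = true

/-- The local consistency of the bits at two successive positions. -/
def Consistent : (φ : LTL AP) → φ.Bits → Set AP → φ.Bits → Prop
  | tt, _, _, _ => True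
  | ff, _, _, _ => True
  | atom _, _, _, _ => True
  | not φ, b, a, b' => φ.Consistent b a b'
  | and φ ψ, b, a, b' => φ.Consistent b.1 a b'.1 ∧ ψ.Consistent b.2 a b'.2
  | or φ ψ, b, a, b' => φ.Consistent b.1 a b'.1 ∧ ψ.Consistent b.2 a b'.2
  | imp φ ψ, b, a, b' => φ.Consistent b.1 a b'.1 ∧ ψ.Consistent b.2 a b'.2
  | iff φ ψ, b, a, b' => φ.Consistent b.1 a b'.1 ∧ ψ.Consistent b.2 a b'.2
  | next φ, b, a, b' => (b.1 = true ↔ φ.Val b.2 a b'.2) ∧ φ.Consistent b.2 a b'.2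
  | eventually φ, b, a, b' =>
      (b.1 = true ↔ φ.Val b.2 a b'.2 ∨ b'.1 = true) ∧ φ.Consistent b.2 a b'.2
  | always φ, b, a, b' =>
      (b.1 = true ↔ φ.Val b.2 a b'.2 ∧ b'.1 = true) ∧ φ.Consistent b.2 a b'.2
  | untl φ ψ, b, a, b' =>
      (b.1 = true ↔ ψ.Val b.2.2 a b'.2.2 ∨ φ.Val b.2.1 a b'.2.1 ∧ b'.1 = true) ∧
      φ.Consistent b.2.1 a b'.2.1 ∧ ψ.Consistent b.2.2 a b'.2.2

/-- The conjunction of the fairness conditions of the operators `F` and `G` in the maximal chain of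
unary operators at the root of the formula. -/
def ChainFair : (φ : LTL AP) → φ.Bits → Set AP → φ.Bits → Prop
  | not φ, b, a, b' => φ.ChainFair b a b'
  | next φ, b, a, b' => φ.ChainFair b.2 a b'.2
  | eventually φ, b, a, b' => φ.ChainFair b.2 a b'.2 ∧ (b.1 = true → φ.Val b.2 a b'.2)
  | always φ, b, a, b' => φ.ChainFair b.2 a b'.2 ∧ (φ.Val b.2 a b'.2 → b.1 = true)
  | _, _, _, _ => True

/-- The fairness conditions for `φ` and `ψ`, as conditions on pairs. -/
def pairFair {B B' A : Type*} (l : List (B → A → B → Prop)) (l' : List (B' → A → B' → Prop)) :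
    List (B × B' → A → B × B' → Prop) :=
  l.map (fun C b a b' => C b.1 a b'.1) ++ l'.map fun C b a b' => C b.2 a b'.2

theorem length_pairFair {B B' A : Type*} (l : List (B → A → B → Prop))
    (l' : List (B' → A → B' → Prop)) : (pairFair l l').length = l.length + l'.length := by
  simp [pairFair]

/-- The fairness conditions for the temporal operators below the maximal chain of unary operators at
the root. -/
def innerFair : (φ : LTL AP) → List (φ.Bits → Set AP → φ.Bits → Prop)
  | tt => []
  | ff => []
  | atom _ => []
  | not φ => φ.innerFair
  | and φ ψ => pairFair (φ.ChainFair :: φ.innerFair) (ψ.ChainFair :: ψ.innerFair)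
  | or φ ψ => pairFair (φ.ChainFair :: φ.innerFair) (ψ.ChainFair :: ψ.innerFair)
  | imp φ ψ => pairFair (φ.ChainFair :: φ.innerFair) (ψ.ChainFair :: ψ.innerFair)
  | iff φ ψ => pairFair (φ.ChainFair :: φ.innerFair) (ψ.ChainFair :: ψ.innerFair)
  | next φ => φ.innerFair.map fun C b a b' => C b.2 a b'.2
  | eventually φ => φ.innerFair.map fun C b a b' => C b.2 a b'.2
  | always φ => φ.innerFair.map fun C b a b' => C b.2 a b'.2
  | untl φ ψ => (fun b a b' => b.1 = true → ψ.Val b.2.2 a b'.2.2) ::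
      (pairFair (φ.ChainFair :: φ.innerFair) (ψ.ChainFair :: ψ.innerFair)).map
        fun C b a b' => C b.2 a b'.2

/-- The sequence `b` of bits satisfies each of the conditions infinitely often. -/
def IsFair {B A : Type*} (l : List (B → A → B → Prop)) (w : ℕ → A) (b : ℕ → B) : Prop :=
  ∀ C ∈ l, ∃ᶠ i in atTop, C (b i) (w i) (b (i + 1))

theorem isFair_cons {B A : Type*} {C : B → A → B → Prop} {l : List (B → A → B → Prop)}
    {w : ℕ → A} {b : ℕ → B} :
    IsFair (C :: l) w b ↔ (∃ᶠ i in atTop, C (b i) (w i) (b (i + 1))) ∧ IsFair l w b := by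
  simp [IsFair]

theorem isFair_map {B B' A : Type*} {l : List (B → A → B → Prop)} (f : B' → B) {w : ℕ → A}
    {b : ℕ → B'} :
    IsFair (l.map fun C b a b' => C (f b) a (f b')) w b ↔ IsFair l w fun i => f (b i) := by
  simp [IsFair]

theorem isFair_pairFair {B B' A : Type*} {l : List (B → A → B → Prop)}
    {l' : List (B' → A → B' → Prop)} {w : ℕ → A} {b : ℕ → B × B'} :
    IsFair (pairFair l l') w b ↔
      IsFair l w (fun i => (b i).1) ∧ IsFair l' w fun i => (b i).2 := by
  simp [IsFair, pairFair, or_imp, forall_and]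

/-! ### Consistent and fair bits are truth values -/

/-- A bit that satisfies the expansion law of `F` and its fairness condition. -/
theorem bit_iff_exists {b p : ℕ → Prop} (hb : ∀ i, b i ↔ p i ∨ b (i + 1))
    (hf : ∃ᶠ i in atTop, b i → p i) (i : ℕ) : b i ↔ ∃ j, i ≤ j ∧ p j := by
  have hp : ∀ d, p (i + d) → b i := by
    intro d
    induction d generalizing i with
    | zero => exact fun h => (hb i).2 (Or.inl h)
    | succ d ih => exact fun h => (hb i).2 (Or.inr (ih (i + 1) (by rwa [add_right_comm])))
  constructor
  · intro hi
    by_contra hcon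
    push Not at hcon
    have hall : ∀ d, b (i + d) := by
      intro d
      induction d with
      | zero => exact hi
      | succ d ih => exact ((hb _).1 ih).resolve_left (hcon _ (by omega))
    obtain ⟨j, hj, hbp⟩ := frequently_atTop.1 hf i
    obtain ⟨d, rfl⟩ := Nat.exists_eq_add_of_le hj
    exact hcon _ hj (hbp (hall d))
  · rintro ⟨j, hj, h⟩
    obtain ⟨d, rfl⟩ := Nat.exists_eq_add_of_le hj
    exact hp d h

theorem bit_iff_forall {b p : ℕ → Prop} (hb : ∀ i, b i ↔ p i ∧ b (i + 1))
    (hf : ∃ᶠ i in atTop, p i → b i) (i : ℕ) : b i ↔ ∀ j, i ≤ j → p j := by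
  have := bit_iff_exists (b := fun i => ¬ b i) (p := fun i => ¬ p i)
    (fun i => by rw [hb i]; tauto) (hf.mono fun i h => by tauto) i
  simpa using not_congr this

/-- A witness propagates backwards through the expansion law without any fairness. Refuting an until
at the root needs only this half, which saves one condition there. -/
theorem until_of_bit_witness {b p q : ℕ → Prop} (hb : ∀ i, b i ↔ q i ∨ p i ∧ b (i + 1)) (i : ℕ)
    (h : ∃ j, i ≤ j ∧ q j ∧ ∀ k, i ≤ k → k < j → p k) : b i := by
  obtain ⟨j, hj, hq, hp⟩ := h
  obtain ⟨d, rfl⟩ := Nat.exists_eq_add_of_le hj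
  clear hj
  induction d generalizing i with
  | zero => exact (hb i).2 (Or.inl hq)
  | succ d ih =>
    refine (hb i).2 (Or.inr ⟨hp i le_rfl (by omega), ih (i + 1) ?_ fun k h1 h2 => ?_⟩)
    · rwa [add_right_comm]
    · exact hp k (by omega) (by omega)

theorem bit_iff_until {b p q : ℕ → Prop} (hb : ∀ i, b i ↔ q i ∨ p i ∧ b (i + 1))
    (hf : ∃ᶠ i in atTop, b i → q i) (i : ℕ) :
    b i ↔ ∃ j, i ≤ j ∧ q j ∧ ∀ k, i ≤ k → k < j → p k := by
  refine ⟨fun hi => ?_, until_of_bit_witness hb i⟩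
  by_contra hcon
  have hall : ∀ d, b (i + d) ∧ ∀ k, i ≤ k → k < i + d → p k := by
    intro d
    induction d with
    | zero => exact ⟨hi, fun k h1 h2 => by omega⟩
    | succ d ih =>
      have hq : ¬ q (i + d) := fun hq => hcon ⟨i + d, by omega, hq, ih.2⟩
      obtain ⟨hp, hb'⟩ := ((hb _).1 ih.1).resolve_left hq
      refine ⟨hb', fun k h1 h2 => ?_⟩
      rcases Nat.lt_succ_iff_lt_or_eq.1 (show k < (i + d).succ by omega) with h | rfl
      · exact ih.2 k h1 h
      · exact hp
  obtain ⟨j, hj, hbq⟩ := frequently_atTop.1 hf i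
  obtain ⟨d, rfl⟩ := Nat.exists_eq_add_of_le hj
  exact hcon ⟨i + d, hj, hbq (hall d).1, (hall d).2⟩

/-- Consistent and fair bits are the truth values. -/
theorem val_iff_satAt (φ : LTL AP) {w : ℕ → Set AP} {b : ℕ → φ.Bits}
    (hc : ∀ i, φ.Consistent (b i) (w i) (b (i + 1)))
    (hf : IsFair (φ.ChainFair :: φ.innerFair) w b) (i : ℕ) :
    φ.Val (b i) (w i) (b (i + 1)) ↔ φ.SatAt w i := by
  induction φ generalizing i with
  | tt | ff | atom => exact Iff.rfl
  | not φ ih => exact not_congr (ih hc hf i)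
  | and φ ψ ih ih' =>
    have h := isFair_pairFair.1 (isFair_cons.1 hf).2
    exact and_congr (ih (fun i => (hc i).1) h.1 i) (ih' (fun i => (hc i).2) h.2 i)
  | or φ ψ ih ih' =>
    have h := isFair_pairFair.1 (isFair_cons.1 hf).2
    exact or_congr (ih (fun i => (hc i).1) h.1 i) (ih' (fun i => (hc i).2) h.2 i)
  | imp φ ψ ih ih' =>
    have h := isFair_pairFair.1 (isFair_cons.1 hf).2
    exact imp_congr (ih (fun i => (hc i).1) h.1 i) (ih' (fun i => (hc i).2) h.2 i)
  | iff φ ψ ih ih' =>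
    have h := isFair_pairFair.1 (isFair_cons.1 hf).2
    exact iff_congr (ih (fun i => (hc i).1) h.1 i) (ih' (fun i => (hc i).2) h.2 i)
  | next φ ih =>
    obtain ⟨h1, h2⟩ := isFair_cons.1 hf
    have h := ih (fun i => (hc i).2) (isFair_cons.2 ⟨h1, (isFair_map Prod.snd).1 h2⟩)
    exact (hc (i + 1)).1.trans (h (i + 1))
  | eventually φ ih =>
    obtain ⟨h1, h2⟩ := isFair_cons.1 hf
    have h := ih (fun i => (hc i).2)
      (isFair_cons.2 ⟨h1.mono fun i hi => hi.1, (isFair_map Prod.snd).1 h2⟩)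
    refine bit_iff_exists (b := fun i => (b i).1 = true) (fun i => ?_)
      (h1.mono fun i hi => ?_) i
    · rw [← h]; exact (hc i).1
    · rw [← h]; exact hi.2
  | always φ ih =>
    obtain ⟨h1, h2⟩ := isFair_cons.1 hf
    have h := ih (fun i => (hc i).2)
      (isFair_cons.2 ⟨h1.mono fun i hi => hi.1, (isFair_map Prod.snd).1 h2⟩)
    refine bit_iff_forall (b := fun i => (b i).1 = true) (fun i => ?_)
      (h1.mono fun i hi => ?_) i
    · rw [← h]; exact (hc i).1
    · rw [← h]; exact hi.2
  | untl φ ψ ih ih' =>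
    obtain ⟨-, h2⟩ := isFair_cons.1 hf
    obtain ⟨h1, h2⟩ := isFair_cons.1 h2
    have h3 := isFair_pairFair.1 ((isFair_map Prod.snd).1 h2)
    have h := ih (fun i => (hc i).2.1) h3.1
    have h' := ih' (fun i => (hc i).2.2) h3.2
    refine bit_iff_until (b := fun i => (b i).1 = true) (fun i => ?_)
      (h1.mono fun i hi => ?_) i
    · rw [← h, ← h']; exact (hc i).1
    · rw [← h']; exact hi

/-! ### Truth values are consistent and fair -/

open Classical in
/-- The bits that are determined by the computation `w` at position `i`. -/
noncomputable def truthBits : (φ : LTL AP) → (ℕ → Set AP) → ℕ → φ.Bits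
  | tt, _, _ => ()
  | ff, _, _ => ()
  | atom _, _, _ => ()
  | not φ, w, i => φ.truthBits w i
  | and φ ψ, w, i => (φ.truthBits w i, ψ.truthBits w i)
  | or φ ψ, w, i => (φ.truthBits w i, ψ.truthBits w i)
  | imp φ ψ, w, i => (φ.truthBits w i, ψ.truthBits w i)
  | iff φ ψ, w, i => (φ.truthBits w i, ψ.truthBits w i)
  | next φ, w, i => (decide (φ.SatAt w i), φ.truthBits w i)
  | eventually φ, w, i => (decide (φ.eventually.SatAt w i), φ.truthBits w i)
  | always φ, w, i => (decide (φ.always.SatAt w i), φ.truthBits w i)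
  | untl φ ψ, w, i => (decide ((φ.untl ψ).SatAt w i), φ.truthBits w i, ψ.truthBits w i)

open Classical in
theorem val_truthBits (φ : LTL AP) (w : ℕ → Set AP) (i : ℕ) :
    φ.Val (φ.truthBits w i) (w i) (φ.truthBits w (i + 1)) ↔ φ.SatAt w i := by
  induction φ generalizing i with
  | tt | ff | atom => exact Iff.rfl
  | not φ ih => exact not_congr (ih i)
  | and φ ψ ih ih' => exact and_congr (ih i) (ih' i)
  | or φ ψ ih ih' => exact or_congr (ih i) (ih' i)
  | imp φ ψ ih ih' => exact imp_congr (ih i) (ih' i)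
  | iff φ ψ ih ih' => exact iff_congr (ih i) (ih' i)
  | next | eventually | always | untl => exact decide_eq_true_iff

theorem eventually_satAt_iff (φ : LTL AP) (w : ℕ → Set AP) (i : ℕ) :
    φ.eventually.SatAt w i ↔ φ.SatAt w i ∨ φ.eventually.SatAt w (i + 1) := by
  simp only [SatAt]
  constructor
  · rintro ⟨j, hj, h⟩
    rcases hj.eq_or_lt with rfl | hj
    · exact Or.inl h
    · exact Or.inr ⟨j, hj, h⟩
  · rintro (h | ⟨j, hj, h⟩)
    · exact ⟨i, le_rfl, h⟩
    · exact ⟨j, by omega, h⟩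

theorem always_satAt_iff (φ : LTL AP) (w : ℕ → Set AP) (i : ℕ) :
    φ.always.SatAt w i ↔ φ.SatAt w i ∧ φ.always.SatAt w (i + 1) := by
  have := eventually_satAt_iff φ.not w i
  simp only [SatAt] at this ⊢
  simpa [not_or] using not_congr this

theorem untl_satAt_iff (φ ψ : LTL AP) (w : ℕ → Set AP) (i : ℕ) :
    (φ.untl ψ).SatAt w i ↔ ψ.SatAt w i ∨ φ.SatAt w i ∧ (φ.untl ψ).SatAt w (i + 1) := by
  simp only [SatAt]
  constructor
  · rintro ⟨j, hj, h, h'⟩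
    rcases hj.eq_or_lt with rfl | hj
    · exact Or.inl h
    · exact Or.inr ⟨h' i le_rfl hj, j, hj, h, fun k hk => h' k (by omega)⟩
  · rintro (h | ⟨h0, j, hj, h, h'⟩)
    · exact ⟨i, le_rfl, h, fun k h1 h2 => by omega⟩
    · refine ⟨j, by omega, h, fun k h1 h2 => ?_⟩
      rcases h1.eq_or_lt with rfl | h1
      · exact h0
      · exact h' k h1 h2

open Classical in
theorem consistent_truthBits (φ : LTL AP) (w : ℕ → Set AP) (i : ℕ) :
    φ.Consistent (φ.truthBits w i) (w i) (φ.truthBits w (i + 1)) := by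
  induction φ with
  | tt | ff | atom => trivial
  | not φ ih => exact ih
  | and φ ψ ih ih' | or φ ψ ih ih' | imp φ ψ ih ih' | iff φ ψ ih ih' => exact ⟨ih, ih'⟩
  | next φ ih => exact ⟨decide_eq_true_iff.trans (φ.val_truthBits w i).symm, ih⟩
  | eventually φ ih =>
    refine ⟨?_, ih⟩
    simp only [truthBits, decide_eq_true_iff, val_truthBits]
    exact eventually_satAt_iff φ w i
  | always φ ih =>
    refine ⟨?_, ih⟩
    simp only [truthBits, decide_eq_true_iff, val_truthBits]
    exact always_satAt_iff φ w i
  | untl φ ψ ih ih' =>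
    refine ⟨?_, ih, ih'⟩
    simp only [truthBits, decide_eq_true_iff, val_truthBits]
    exact untl_satAt_iff φ ψ w i

/-- `F p` can only change from true to false: it holds forever if `p` recurs, and fails from some
point on otherwise. -/
theorem eventually_const_exists (p : ℕ → Prop) :
    (∀ᶠ i in atTop, ∃ j, i ≤ j ∧ p j) ∨ ∀ᶠ i in atTop, ¬ ∃ j, i ≤ j ∧ p j := by
  by_cases h : ∃ᶠ i in atTop, p i
  · refine Or.inl (Eventually.of_forall fun i => ?_)
    obtain ⟨j, hj, hp⟩ := frequently_atTop.1 h i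
    exact ⟨j, hj, hp⟩
  · obtain ⟨a, ha⟩ := eventually_atTop.1 (not_frequently.1 h)
    refine Or.inr (eventually_atTop.2 ⟨a, fun i hi => ?_⟩)
    rintro ⟨j, hj, hp⟩
    exact ha j (hi.trans hj) hp

/-- Either `p` recurs, or `F p` is eventually false and the implication is vacuous. -/
theorem frequently_exists_imp (p : ℕ → Prop) :
    ∃ᶠ i in atTop, (∃ j, i ≤ j ∧ p j) → p i := by
  by_cases h : ∃ᶠ i in atTop, p i
  · exact h.mono fun i hi _ => hi
  · obtain ⟨a, ha⟩ := eventually_atTop.1 (not_frequently.1 h)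
    refine (eventually_atTop.2 ⟨a, fun i hi => ?_⟩).frequently
    rintro ⟨j, hj, hp⟩
    exact absurd hp (ha j (hi.trans hj))

/-- For eventually constant `p` the fairness condition holds at all late positions, not just
recurrently, and can thus be intersected with any recurrent condition. -/
theorem eventually_exists_imp {p : ℕ → Prop}
    (h : (∀ᶠ i in atTop, p i) ∨ ∀ᶠ i in atTop, ¬ p i) :
    ∀ᶠ i in atTop, (∃ j, i ≤ j ∧ p j) → p i := by
  rcases h with h | h
  · exact h.mono fun i hi _ => hi
  · obtain ⟨a, ha⟩ := eventually_atTop.1 h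
    refine eventually_atTop.2 ⟨a, fun i hi => ?_⟩
    rintro ⟨j, hj, hp⟩
    exact absurd hp (ha j (hi.trans hj))

/-- Above the innermost operator `F` or `G` of a chain of unary operators, all truth values are
eventually constant; thus the fairness conditions of the chain can be met simultaneously. -/
theorem chainFair_truthBits_aux (φ : LTL AP) (w : ℕ → Set AP) :
    (∀ i, φ.ChainFair (φ.truthBits w i) (w i) (φ.truthBits w (i + 1))) ∨
    ((∀ᶠ i in atTop, φ.SatAt w i) ∨ ∀ᶠ i in atTop, ¬ φ.SatAt w i) ∧
      ∃ᶠ i in atTop, φ.ChainFair (φ.truthBits w i) (w i) (φ.truthBits w (i + 1)) := by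
  induction φ with
  | tt | ff | atom | and | or | imp | iff | untl => exact Or.inl fun _ => trivial
  | not φ ih =>
    refine ih.imp id (And.imp_left fun h => h.symm.imp id fun h => ?_)
    simpa [SatAt] using h
  | next φ ih =>
    refine ih.imp id (And.imp_left fun h => h.imp (fun h => ?_) fun h => ?_)
    · exact (tendsto_add_atTop_nat 1).eventually h
    · exact (tendsto_add_atTop_nat 1).eventually h
  | eventually φ ih =>
    refine Or.inr ⟨eventually_const_exists _, ?_⟩
    simp only [ChainFair, truthBits, val_truthBits, decide_eq_true_iff]
    rcases ih with h | ⟨h, h'⟩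
    · exact (frequently_exists_imp (φ.SatAt w)).mono fun i hi => ⟨h i, hi⟩
    · exact h'.and_eventually (eventually_exists_imp h)
  | always φ ih =>
    -- The fairness condition of `G φ` is that of `F ¬φ`, which reduces this case to the previous
    -- one.
    have key : ∀ i, (φ.SatAt w i → φ.always.SatAt w i) ↔
        ((∃ j, i ≤ j ∧ ¬ φ.SatAt w j) → ¬ φ.SatAt w i) := fun i => by
      rw [← not_imp_not]
      simp [SatAt]
    refine Or.inr ⟨?_, ?_⟩
    · have := eventually_const_exists fun i => ¬ φ.SatAt w i
      rw [or_comm]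
      simpa [SatAt] using this
    simp only [ChainFair, truthBits, val_truthBits, decide_eq_true_iff, key]
    rcases ih with h | ⟨h, h'⟩
    · exact (frequently_exists_imp fun i => ¬ φ.SatAt w i).mono fun i hi => ⟨h i, hi⟩
    · exact h'.and_eventually (eventually_exists_imp (h.symm.imp id (by simp)))

theorem frequently_chainFair_truthBits (φ : LTL AP) (w : ℕ → Set AP) :
    ∃ᶠ i in atTop, φ.ChainFair (φ.truthBits w i) (w i) (φ.truthBits w (i + 1)) := by
  rcases φ.chainFair_truthBits_aux w with h | h
  · exact (Eventually.of_forall h).frequently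
  · exact h.2

theorem isFair_truthBits (φ : LTL AP) (w : ℕ → Set AP) :
    IsFair (φ.ChainFair :: φ.innerFair) w (φ.truthBits w) := by
  refine isFair_cons.2 ⟨φ.frequently_chainFair_truthBits w, ?_⟩
  have pair : ∀ {φ ψ : LTL AP}, IsFair φ.innerFair w (φ.truthBits w) →
      IsFair ψ.innerFair w (ψ.truthBits w) →
      IsFair (pairFair (φ.ChainFair :: φ.innerFair) (ψ.ChainFair :: ψ.innerFair)) w
        fun i => (φ.truthBits w i, ψ.truthBits w i) := fun h h' =>
    isFair_pairFair.2 ⟨isFair_cons.2 ⟨frequently_chainFair_truthBits _ w, h⟩,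
      isFair_cons.2 ⟨frequently_chainFair_truthBits _ w, h'⟩⟩
  induction φ with
  | tt | ff | atom => intro C hC; exact absurd hC List.not_mem_nil
  | not φ ih => exact ih
  | and φ ψ ih ih' | or φ ψ ih ih' | imp φ ψ ih ih' | iff φ ψ ih ih' => exact pair ih ih'
  | next φ ih | eventually φ ih | always φ ih => exact (isFair_map Prod.snd).2 ih
  | untl φ ψ ih ih' =>
    refine isFair_cons.2 ⟨?_, (isFair_map Prod.snd).2 (pair ih ih')⟩
    simp only [truthBits, val_truthBits, decide_eq_true_iff]
    exact (frequently_exists_imp (ψ.SatAt w)).mono fun i hi ⟨j, hj, h, _⟩ => hi ⟨j, hj, h⟩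

/-! ### Counting states and fairness conditions -/

/-- The number of temporal operators. -/
def temporalCount : LTL AP → ℕ
  | tt => 0
  | ff => 0
  | atom _ => 0
  | not φ => φ.temporalCount
  | and φ ψ => φ.temporalCount + ψ.temporalCount
  | or φ ψ => φ.temporalCount + ψ.temporalCount
  | imp φ ψ => φ.temporalCount + ψ.temporalCount
  | iff φ ψ => φ.temporalCount + ψ.temporalCount
  | next φ => φ.temporalCount + 1
  | eventually φ => φ.temporalCount + 1
  | always φ => φ.temporalCount + 1
  | untl φ ψ => φ.temporalCount + ψ.temporalCount + 1

theorem finite_bits_and_card (φ : LTL AP) :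
    Finite φ.Bits ∧ Nat.card φ.Bits = 2 ^ φ.temporalCount := by
  induction φ with
  | tt | ff | atom => exact ⟨inferInstanceAs (Finite Unit), Nat.card_unique (α := Unit)⟩
  | not φ ih => exact ih
  | and φ ψ ih ih' | or φ ψ ih ih' | imp φ ψ ih ih' | iff φ ψ ih ih' =>
    obtain ⟨h, hc⟩ := ih
    obtain ⟨h', hc'⟩ := ih'
    refine ⟨inferInstanceAs (Finite (φ.Bits × ψ.Bits)), ?_⟩
    exact (Nat.card_prod _ _).trans (by rw [hc, hc', temporalCount, pow_add])
  | next φ ih | eventually φ ih | always φ ih =>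
    obtain ⟨h, hc⟩ := ih
    refine ⟨inferInstanceAs (Finite (Bool × φ.Bits)), ?_⟩
    exact (Nat.card_prod _ _).trans (by rw [hc, temporalCount, pow_succ']; simp)
  | untl φ ψ ih ih' =>
    obtain ⟨h, hc⟩ := ih
    obtain ⟨h', hc'⟩ := ih'
    refine ⟨inferInstanceAs (Finite (Bool × φ.Bits × ψ.Bits)), ?_⟩
    refine (Nat.card_prod _ _).trans ?_
    rw [Nat.card_prod, hc, hc', temporalCount, pow_succ', pow_add]; simp

instance (φ : LTL AP) : Finite φ.Bits := φ.finite_bits_and_card.1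

theorem card_bits (φ : LTL AP) : Nat.card φ.Bits = 2 ^ φ.temporalCount :=
  φ.finite_bits_and_card.2

/-- The number of fairness conditions is linear in the number of non-temporal nodes. -/
theorem exists_length_eq (φ : LTL AP) :
    ∃ s, φ.length = φ.temporalCount + s ∧ φ.innerFair.length + 3 ≤ 3 * s := by
  -- The bound `3 * s - 3` is forced by until: it adds its own condition and the chain conditions of
  -- both arguments, three in all, but no non-temporal node. A leaf attains it with `s = 1`.
  have pair : ∀ {φ ψ : LTL AP} {s s' k : ℕ}, φ.innerFair.length + 3 ≤ 3 * s →
      ψ.innerFair.length + 3 ≤ 3 * s' → k ≤ 4 →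
      (pairFair (φ.ChainFair :: φ.innerFair) (ψ.ChainFair :: ψ.innerFair)).length + k ≤
        3 * (s + s') := fun h h' hk => by
    rw [length_pairFair, List.length_cons, List.length_cons]
    omega
  induction φ with
  | tt | ff | atom => exact ⟨1, rfl, le_rfl⟩
  | not φ ih =>
    obtain ⟨s, h, h'⟩ := ih
    exact ⟨s + 1, congrArg (· + 1) h, h'.trans (by omega)⟩
  | and φ ψ ih ih' | or φ ψ ih ih' | imp φ ψ ih ih' | iff φ ψ ih ih' =>
    obtain ⟨s, h, hs⟩ := ih
    obtain ⟨s', h', hs'⟩ := ih'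
    refine ⟨s + s' + 1, ?_, (pair hs hs' (by norm_num)).trans (by omega)⟩
    simp only [length, temporalCount]
    omega
  | next φ ih | eventually φ ih | always φ ih =>
    obtain ⟨s, h, h'⟩ := ih
    refine ⟨s, by simp only [length, temporalCount]; omega, ?_⟩
    simp only [innerFair]
    rw [List.length_map]
    exact h'
  | untl φ ψ ih ih' =>
    obtain ⟨s, h, hs⟩ := ih
    obtain ⟨s', h', hs'⟩ := ih'
    refine ⟨s + s', by simp only [length, temporalCount]; omega, ?_⟩
    simp only [innerFair]
    rw [List.length_cons, List.length_map, add_assoc]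
    exact pair hs hs' (by norm_num)

/-- Here `2 ^ t` counts the bit vectors, `k` the counter values, and the extra state is the initial
one. -/
theorem two_pow_mul_add_one_le {t k s l : ℕ} (hl : l = t + s) (hk : k < 2 ^ s) :
    2 ^ t * k + 1 ≤ 2 ^ l := by
  subst hl
  calc 2 ^ t * k + 1 ≤ 2 ^ t * k + 2 ^ t := by gcongr; exact Nat.one_le_two_pow
    _ = 2 ^ t * (k + 1) := by ring
    _ ≤ 2 ^ t * 2 ^ s := by gcongr; exact hk
    _ = 2 ^ (t + s) := (pow_add _ _ _).symm

theorem three_mul_lt_two_pow {s : ℕ} (hs : 2 ≤ s) : 3 * s < 2 ^ s + 3 := by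
  induction s, hs using Nat.le_induction with
  | base => norm_num
  | succ n hn ih =>
    have : 2 ^ 2 ≤ 2 ^ n := Nat.pow_le_pow_right (by norm_num) hn
    rw [pow_succ]
    omega

/-! ### Automata for the negated formula -/

/-- An automaton that guesses the bits of `φ`. -/
theorem buchiRecognizable_bits (φ : LTL AP) (I T : φ.Bits → Set AP → φ.Bits → Prop)
    (Cs : List (φ.Bits → Set AP → φ.Bits → Prop)) {s l : ℕ} (hl : l = φ.temporalCount + s)
    (hk : Cs.length + 1 < 2 ^ s) :
    BuchiRecognizable (2 ^ l) fun w => ∃ b : ℕ → φ.Bits, I (b 0) (w 0) (b 1) ∧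
      (∀ i, T (b i) (w i) (b (i + 1))) ∧ IsFair Cs w b := by
  refine (buchiRecognizable_of_fair I T Cs).mono ?_
  rw [card_bits]
  exact two_pow_mul_add_one_le hl hk

theorem buchiRecognizable_not_of_length {φ : LTL AP} {s : ℕ}
    (hl : φ.length = φ.temporalCount + s) (hk : φ.innerFair.length + 2 < 2 ^ s) :
    BuchiRecognizable (2 ^ φ.length) fun w => ¬ φ.Sat w := by
  refine (φ.buchiRecognizable_bits (fun b a b' => ¬ φ.Val b a b') φ.Consistent
    (φ.ChainFair :: φ.innerFair) hl hk).congr fun w => ⟨?_, fun h => ?_⟩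
  · rintro ⟨b, h0, hc, hf⟩
    rwa [φ.val_iff_satAt hc hf 0] at h0
  · exact ⟨φ.truthBits w, by rwa [val_truthBits], φ.consistent_truthBits w, φ.isFair_truthBits w⟩

/-- With `s = 1` only two states are available, which leaves no room even for the trivial condition
`ChainFair`; a leaf is decided by the first letter alone. -/
theorem buchiRecognizable_not_leaf {φ : LTL AP} (hl : φ.length = φ.temporalCount + 1)
    (hval : ∀ w b, φ.Val b (w 0) b ↔ φ.Sat w) (hb : Subsingleton φ.Bits) :
    BuchiRecognizable (2 ^ φ.length) fun w => ¬ φ.Sat w := by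
  refine (φ.buchiRecognizable_bits (fun b a b' => ¬ φ.Val b a b') (fun _ _ _ => True) [] hl
    (by simp)).congr fun w => ⟨?_, fun h => ?_⟩
  · rintro ⟨b, h0, -⟩
    rwa [Subsingleton.elim (b 1) (b 0), hval] at h0
  · refine ⟨φ.truthBits w, by rwa [val_truthBits], fun _ => trivial, fun C hC => ?_⟩
    exact absurd hC List.not_mem_nil

/-- Here `s` counts the root as well, even when the root is an until. Each argument has at least one
non-temporal node, whence `3 ≤ s`. -/
theorem exists_length_eq_binary (φ ψ : LTL AP) :
    ∃ s, 3 ≤ s ∧ φ.length + ψ.length + 1 = φ.temporalCount + ψ.temporalCount + s ∧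
      (pairFair (φ.ChainFair :: φ.innerFair) (ψ.ChainFair :: ψ.innerFair)).length + 7 ≤ 3 * s := by
  obtain ⟨s, h, hs⟩ := φ.exists_length_eq
  obtain ⟨s', h', hs'⟩ := ψ.exists_length_eq
  refine ⟨s + s' + 1, by omega, by omega, ?_⟩
  simp only [pairFair, List.length_append, List.length_map, List.length_cons]
  omega

open Classical in
/-- The complement of the language of `φ` is recognized with `2 ^ |φ|` states. -/
theorem buchiRecognizable_not_sat (φ : LTL AP) :
    BuchiRecognizable (2 ^ φ.length) fun w => ¬ φ.Sat w := by
  have succ_le : ∀ n, 2 ^ n + 1 ≤ 2 ^ (n + 1) := fun n => by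
    have := Nat.one_le_two_pow (n := n)
    rw [pow_succ]
    omega
  -- At a root `¬` or `F` only the bits of the argument are guessed, so the root contributes one
  -- further unit to the exponent.
  have unary : ∀ φ : LTL AP, ∃ s, φ.length + 1 = φ.temporalCount + s ∧
      φ.innerFair.length + 1 + 1 < 2 ^ s := fun φ => by
    obtain ⟨s, h, hs⟩ := φ.exists_length_eq
    refine ⟨s + 1, by omega, ?_⟩
    have := three_mul_lt_two_pow (s := s + 1) (by omega)
    omega
  induction φ with
  | tt | ff | atom =>
    exact buchiRecognizable_not_leaf rfl (fun _ _ => Iff.rfl) (inferInstanceAs (Subsingleton Unit))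
  | not φ ih =>
    obtain ⟨s, hl, hs⟩ := unary φ
    refine (φ.buchiRecognizable_bits φ.Val φ.Consistent (φ.ChainFair :: φ.innerFair) hl
      hs).congr fun w => ⟨?_, fun h => ?_⟩
    · rintro ⟨b, h0, hc, hf⟩
      exact not_not_intro ((φ.val_iff_satAt hc hf 0).1 h0)
    · exact ⟨φ.truthBits w, (φ.val_truthBits w 0).2 (not_not.1 h), φ.consistent_truthBits w,
        φ.isFair_truthBits w⟩
  | and φ ψ ih ih' | or φ ψ ih ih' | imp φ ψ ih ih' | iff φ ψ ih ih' =>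
    obtain ⟨s, h3, hl, hs⟩ := exists_length_eq_binary φ ψ
    refine buchiRecognizable_not_of_length (s := s) hl ?_
    have := three_mul_lt_two_pow (s := s) (by omega)
    exact (show (pairFair (φ.ChainFair :: φ.innerFair) (ψ.ChainFair :: ψ.innerFair)).length + 2 <
      2 ^ s by omega)
  | next φ ih =>
    refine (ih.next.mono (succ_le _)).congr fun w => not_congr ?_
    exact (φ.satAt_add_iff w 1 0).symm
  | eventually φ ih =>
    -- `¬F φ` is the safety condition `G ¬φ`: the transitions enforce it, and the root needs neither
    -- a bit nor a fairness condition.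
    obtain ⟨s, hl, hs⟩ := unary φ
    refine (φ.buchiRecognizable_bits (fun _ _ _ => True)
      (fun b a b' => φ.Consistent b a b' ∧ ¬ φ.Val b a b') (φ.ChainFair :: φ.innerFair) hl
      hs).congr fun w => ⟨?_, fun h => ?_⟩
    · rintro ⟨b, -, hc, hf⟩ ⟨j, -, hj⟩
      exact (hc j).2 ((φ.val_iff_satAt (fun i => (hc i).1) hf j).2 hj)
    · refine ⟨φ.truthBits w, trivial, fun i => ⟨φ.consistent_truthBits w i, fun hi => ?_⟩,
        φ.isFair_truthBits w⟩
      exact h ⟨i, Nat.zero_le _, (φ.val_truthBits w i).1 hi⟩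
  | always φ ih =>
    refine (ih.eventually.mono (succ_le _)).congr fun w => ?_
    rw [← not_forall]
    refine not_congr (forall_congr' fun j => ?_)
    have := φ.satAt_add_iff w j 0
    rw [zero_add] at this
    simp [Sat, ← this]
  | untl φ ψ ih ih' =>
    obtain ⟨s, h3, hl, hs⟩ := exists_length_eq_binary φ ψ
    -- The root until is temporal, so it is moved from `s` to the bit count. The smaller exponent
    -- still suffices because the fairness condition of the root and the trivial chain condition are
    -- dropped.
    obtain ⟨s, rfl⟩ : ∃ r, s = r + 1 := ⟨s - 1, by omega⟩
    refine ((φ.untl ψ).buchiRecognizable_bits (s := s) (fun b _ _ => b.1 = false)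
      (φ.untl ψ).Consistent
      ((pairFair (φ.ChainFair :: φ.innerFair) (ψ.ChainFair :: ψ.innerFair)).map
        fun C b a b' => C b.2 a b'.2) ?_ ?_).congr fun w => ⟨?_, fun h => ?_⟩
    · simp only [length, temporalCount]
      omega
    · have := three_mul_lt_two_pow (s := s) (by omega)
      rw [List.length_map]
      omega
    · rintro ⟨b, h0, hc, hf⟩ hsat
      have h := isFair_pairFair.1 ((isFair_map Prod.snd).1 hf)
      have h1 := φ.val_iff_satAt (fun i => (hc i).2.1) h.1
      have h2 := ψ.val_iff_satAt (fun i => (hc i).2.2) h.2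
      have := until_of_bit_witness (b := fun i => (b i).1 = true)
        (fun i => by rw [← h1, ← h2]; exact (hc i).1) 0 hsat
      simp [h0] at this
    · refine ⟨(φ.untl ψ).truthBits w, decide_eq_false h, (φ.untl ψ).consistent_truthBits w, ?_⟩
      exact (isFair_cons.1 (isFair_cons.1 ((φ.untl ψ).isFair_truthBits w)).2).2

end LTL

/-! ### Run trees and state sequences along branches -/

namespace UCT

variable {A D : Type*}

theorem wordPrefix_succ (w : ℕ → D) (n : ℕ) : wordPrefix w (n + 1) = wordPrefix w n ++ [w n] := by
  simp [wordPrefix, List.range_succ]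

theorem run_append_iff (𝒜 : UCT A D) (ℓ : LabeledTree A D) {y : List (D × 𝒜.State)}
    {s : D × 𝒜.State} {x : List D} {q : 𝒜.State} :
    𝒜.Run ℓ (y ++ [s]) x q ↔ ∃ x' q', 𝒜.Run ℓ y x' q' ∧ x = x' ++ [s.1] ∧ q = s.2 ∧
      s.2 ∈ 𝒜.trans q' (ℓ x' s.1) s.1 := by
  constructor
  · intro h
    generalize hy : y ++ [s] = z at h
    cases h with
    | root => simp at hy
    | succ a q'' hr ht =>
      obtain ⟨rfl, hs⟩ := List.append_inj' hy rfl
      obtain rfl : s = (a, q) := by simpa using hs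
      exact ⟨_, _, hr, rfl, rfl, ht⟩
  · rintro ⟨x', q', hr, rfl, rfl, ht⟩
    exact Run.succ s.1 s.2 hr ht

/-- The states along a path of the run tree. -/
def stateSeq (𝒜 : UCT A D) (π : ℕ → D × 𝒜.State) : ℕ → 𝒜.State
  | 0 => 𝒜.init
  | n + 1 => (π n).2

/-- A node of the run tree determines the input node it reads and its state, so an infinite path is
just a branch together with a state sequence. -/
theorem run_wordPrefix (𝒜 : UCT A D) {ℓ : LabeledTree A D} {π : ℕ → D × 𝒜.State} {n : ℕ}
    {x : List D} {q : 𝒜.State} (h : 𝒜.Run ℓ (wordPrefix π n) x q) :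
    x = wordPrefix (fun i => (π i).1) n ∧ q = 𝒜.stateSeq π n := by
  induction n generalizing x q with
  | zero =>
    generalize hy : wordPrefix π 0 = z at h
    cases h with
    | root => exact ⟨rfl, rfl⟩
    | succ => simp [wordPrefix] at hy
  | succ n ih =>
    rw [wordPrefix_succ, run_append_iff] at h
    obtain ⟨x', q', hr, rfl, rfl, -⟩ := h
    rw [wordPrefix_succ, (ih hr).1]
    exact ⟨rfl, rfl⟩

theorem isPath_iff (𝒜 : UCT A D) (ℓ : LabeledTree A D) (π : ℕ → D × 𝒜.State) :
    𝒜.IsPath ℓ π ↔ ∀ n, (π n).2 ∈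
      𝒜.trans (𝒜.stateSeq π n) (ℓ.along (fun i => (π i).1) n) (π n).1 := by
  constructor
  · intro h n
    obtain ⟨x, q, hr⟩ := h (n + 1)
    rw [wordPrefix_succ, run_append_iff] at hr
    obtain ⟨x', q', hr, -, -, ht⟩ := hr
    obtain ⟨rfl, rfl⟩ := 𝒜.run_wordPrefix hr
    exact ht
  · intro h n
    induction n with
    | zero => exact ⟨_, _, Run.root⟩
    | succ n ih =>
      obtain ⟨x, q, hr⟩ := ih
      obtain ⟨rfl, rfl⟩ := 𝒜.run_wordPrefix hr
      rw [wordPrefix_succ]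
      exact ⟨_, _, (𝒜.run_append_iff ℓ).2 ⟨_, _, hr, rfl, rfl, h n⟩⟩

theorem mem_infStates_iff (𝒜 : UCT A D) {ℓ : LabeledTree A D} {π : ℕ → D × 𝒜.State}
    (h : 𝒜.IsPath ℓ π) (q : 𝒜.State) :
    q ∈ 𝒜.infStates ℓ π ↔ ∃ᶠ n in atTop, 𝒜.stateSeq π n = q := by
  rw [Nat.frequently_atTop_iff_infinite]
  refine iff_of_eq (congrArg Set.Infinite (Set.ext fun n => ⟨?_, ?_⟩))
  · rintro ⟨x, hx⟩
    exact (𝒜.run_wordPrefix hx).2.symm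
  · rintro rfl
    obtain ⟨x, q, hr⟩ := h n
    exact ⟨x, (𝒜.run_wordPrefix hr).2 ▸ hr⟩

/-- Acceptance in terms of the sequences of states along the branches of the input tree. -/
theorem accepts_iff (𝒜 : UCT A D) (ℓ : LabeledTree A D) :
    𝒜.Accepts ℓ ↔ ∀ (w : ℕ → D) (ρ : ℕ → 𝒜.State), ρ 0 = 𝒜.init →
      (∀ n, ρ (n + 1) ∈ 𝒜.trans (ρ n) (ℓ.along w n) (w n)) → ¬ ∃ᶠ n in atTop, ρ n ∈ 𝒜.acc := by
  have := 𝒜.finite_state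
  constructor
  · intro h w ρ h0 hs hacc
    let π : ℕ → D × 𝒜.State := fun n => (w n, ρ (n + 1))
    have hρ : 𝒜.stateSeq π = ρ := funext fun n => by
      cases n with
      | zero => exact h0.symm
      | succ n => rfl
    have hπ : 𝒜.IsPath ℓ π := (𝒜.isPath_iff ℓ π).2 fun n => by rw [hρ]; exact hs n
    -- Pigeonhole: with finitely many states, leaving each accepting state for good means leaving
    -- the whole accepting set for good.
    have hnot : ∀ q, ∀ᶠ n in atTop, q ∈ 𝒜.acc → ρ n ≠ q := fun q => by
      by_cases hq : q ∈ 𝒜.acc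
      · have hn : q ∉ 𝒜.infStates ℓ π := fun hq' =>
          (h π hπ).le (show q ∈ 𝒜.infStates ℓ π ∩ 𝒜.acc from ⟨hq', hq⟩)
        rw [𝒜.mem_infStates_iff hπ, not_frequently, hρ] at hn
        exact hn.mono fun n hn _ => hn
      · exact Eventually.of_forall fun n h => absurd h hq
    obtain ⟨n, hn, hn'⟩ := (hacc.and_eventually (eventually_all.2 hnot)).exists
    exact hn' (ρ n) hn rfl
  · intro h π hπ
    refine Set.eq_empty_iff_forall_notMem.2 fun q hq => ?_
    refine h (fun n => (π n).1) (𝒜.stateSeq π) rfl ((𝒜.isPath_iff ℓ π).1 hπ) ?_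
    exact ((𝒜.mem_infStates_iff hπ q).1 hq.1).mono fun n hn => hn ▸ hq.2

end UCT

/-! ### The product of the word automaton with the memory -/

theorem mainTheorem3 {V H C G M : Type*} [Finite M] (φ : LTL (Signal V H C G)) (m₀ : M) :
    ∃ 𝒜 : UCT (Set C × Program M H G) (Set V),
      Nat.card 𝒜.State = 2 ^ φ.length * Nat.card M ∧
      ∀ ℓ : LabeledTree (Set C × Program M H G) (Set V), 𝒜.Accepts ℓ ↔ IsGood φ m₀ ℓ := by
  obtain ⟨N, hN⟩ := φ.buchiRecognizable_not_sat
  -- States live in `Type`, whereas `M` may lie in a higher universe; memories are therefore encoded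
  -- by numbers.
  let e := Finite.equivFin M
  let 𝒜 : UCT (Set C × Program M H G) (Set V) :=
    { State := Fin (2 ^ φ.length) × Fin (Nat.card M)
      finite_state := inferInstance
      init := (N.init, e m₀)
      trans := fun s σ v => {t | ∃ h, e.symm t.2 = (σ.2 (e.symm s.2, h)).1 ∧
        N.trans s.1 (joinAssignment v h σ.1 (σ.2 (e.symm s.2, h)).2) t.1}
      acc := {s | s.1 ∈ N.acc} }
  refine ⟨𝒜, by simp [𝒜], fun ℓ => ?_⟩
  rw [UCT.accepts_iff]
  refine forall_congr' fun wV => ?_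
  have hsat : ∀ w, φ.Sat w ↔ ¬ N.Accepts w := fun w => by rw [hN, not_not]
  simp_rw [hsat]
  constructor
  · rintro h wH ⟨σ, h0, hs, ha⟩
    refine h (fun n => (σ n, e (memorySeq m₀ (fun i => (ℓ.along wV i).2) wH n)))
      (Prod.ext h0 rfl) (fun n => ⟨wH n, ?_, ?_⟩) ha
    · simp [memorySeq]
    · simpa [operation] using hs n
  · intro h ρ h0 hs ha
    -- Each step of a path hides an assignment to the hidden signals; collecting them gives the
    -- hidden sequence on which the tree violates `φ`.
    choose wH hm hδ using hs
    have hmem : ∀ n, e.symm (ρ n).2 = memorySeq m₀ (fun i => (ℓ.along wV i).2) wH n := fun n => by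
      induction n with
      | zero => simp [h0, 𝒜, memorySeq]
      | succ n ih => rw [hm, ih, memorySeq]
    refine h wH ⟨fun n => (ρ n).1, by simp [h0, 𝒜], fun n => ?_, ha⟩
    have := hδ n
    rwa [hmem] at this
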